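/- Let $\Theta$ be a measurable space with a $\sigma$-finite reference measure $\mathrm d\theta$, let $p$ be a prior probability density on $\Theta$, and let $Q(\theta,\mathrm d\theta')=Q(\theta,\theta')\,\mathrm d\theta'$ be a Markov proposal kernel with a jointly measurable density. Let $Y=(Y_1,\dots,Y_N)$ be the data and, for $1\le n\le N$, let $\mathsf U_n$ be the set of subsets $U\subseteq\{1,\dots,N\}$ with $|U|=n$; write $Y_U$ for the corresponding subsample. Let $f(\cdot\mid\theta)$ be a likelihood model (for samples of every size), measurable in $\theta$, with $f(Y\mid\theta)>0$ and $f(Y_U\mid\theta)>0$ for all $\theta\in\Theta$, $U\in\mathsf U_n$, and with $\int p(\theta)f(Y\mid\theta)\,\mathrm d\theta<\infty$. Put $\pi(\mathrm d\theta)\propto p(\theta)f(Y\mid\theta)\,\mathrm d\theta$ and $\tilde\pi_n(\mathrm d\theta\mid Y_U)\propto p(\theta)f(Y_U\mid\theta)^{N/n}\,\mathrm d\theta$. Let $K$ be the Metropolis–Hastings (MH) kernel with proposal $Q$ and target $\pi$, whose acceptance probability is $1\wedge a(\theta,\theta')$ with $$a(\theta,\theta')=\frac{\pi(\theta')Q(\theta',\theta)}{\pi(\theta)Q(\theta,\theta')}$$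 (and $a(\theta,\theta')=1$ if the denominator vanishes), and let $K(\theta,\cdot\mid U)$ be the MH kernel with proposal $Q$ and target $\tilde\pi_n(\cdot\mid Y_U)$. Let $S$ be a summary-statistics map, assigning to each sample a vector in $\mathbb R^s$, let $\epsilon\ge 0$, and set $$\Delta_n(U)=S(Y)-\tfrac Nn S(Y_U),\qquad \nu_{n,\epsilon}(U)\propto e^{-\epsilon\|\Delta_n(U)\|^2}\quad(U\in\mathsf U_n).$$ When the subsets used at the successive iterations are i.i.d. with law $\nu_{n,\epsilon}$, the marginal Informed Sub-Sampling MCMC (ISS-MCMC) chain on $\Theta$ has transition kernel $$\tilde K_{n,\epsilon}(\theta,\cdot)=\sum_{U\in\mathsf U_n}\nu_{n,\epsilon}(U)\,K(\theta,\cdot\mid U).$$ Let $\|\mu-\mu'\|=\sup_A|\mu(A)-\mu'(A)|$ be the total variation distance, and define, with values in $[0,\infty]$, $$\phi_U(\theta)=\frac{f(Y_U\mid\theta)^{N/n}}{f(Y\mid\theta)},\qquad A_n=\sum_{U\in\mathsf U_n}\nu_{n,\epsilon}(U)\,\sup_{\theta\in\Theta}\frac1{\phi_U(\theta)},$$ $$B_n(\theta,U)=\int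 Q(\theta,\mathrm d\theta')\,a(\theta,\theta')\,|\phi_U(\theta)-\phi_U(\theta')|.$$ Assume that $K$ is uniformly ergodic: for some constants $C<\infty$ and $\varrho\in(0,1)$, $\sup_{\theta_0\in\Theta}\|\pi-K^i(\theta_0,\cdot)\|\le C\varrho^i$ for all $i\in\mathbb N$. Assume also that, for the given $n$, there is a constant $\gamma_n<\infty$ such that for all $(\theta,U)\in\Theta\times\mathsf U_n$ $$\Bigl|\log f(Y\mid\theta)-\tfrac Nn\log f(Y_U\mid\theta)\Bigr|\le\gamma_n\,N\,\Bigl\|\tfrac{S(Y)}{N}-\tfrac{S(Y_U)}{n}\Bigr\| .$$ Then there is a constant $\kappa<\infty$, depending only on $C$ and $\varrho$, such that the following hold. 1. For all $i\in\mathbb N$ and $\theta_0\in\Theta$, $$\|K^i(\theta_0,\cdot)-\tilde K_{n,\epsilon}^i(\theta_0,\cdot)\|\le\kappa A_n\sup_{(\theta,U)\in\Theta\times\mathsf U_n}B_n(\theta,U).$$ 2. The limit below exists and $$\lim_{i\to\infty}\sup_{\theta\in\Theta}\|\pi-\tilde K_{n,\epsilon}^i(\theta,\cdot)\|\le\kappa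 A_n\sup_{(\theta,U)\in\Theta\times\mathsf U_n}B_n(\theta,U).$$ 3. The kernel $\tilde K_{n,\epsilon}$ of the marginal ISS-MCMC chain admits an invariant probability distribution $\tilde\pi_n$ with $$\|\pi-\tilde\pi_n\|\le\kappa A_n\sup_{(\theta,U)\in\Theta\times\mathsf U_n}B_n(\theta,U).$$ -/

import Mathlib

open MeasureTheory ProbabilityTheory Filter Topology
open scoped ENNReal NNReal

universe u v

noncomputable section

namespace ISSMCMC

/-- Total variation distance `sup_A |μ(A) - ν(A)|` (supremum over measurable sets). For probability
measures with densities `g`, `h` with respect to a common measure it is `(1/2) ∫ |g - h|`. -/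
def tvDist {Θ : Type u} [MeasurableSpace Θ] (μ ν : Measure Θ) : ℝ≥0∞ :=
  ⨆ (A : Set Θ) (_ : MeasurableSet A), ENNReal.ofReal |μ.real A - ν.real A|

/-- `p` is a probability density with respect to `lam`. -/
structure IsProbDensity {Θ : Type u} [MeasurableSpace Θ] (lam : Measure Θ) (p : Θ → ℝ) :
    Prop where
  measurable : Measurable p
  nonneg : ∀ θ, 0 ≤ p θ
  lintegral_eq_one : ∫⁻ θ, ENNReal.ofReal (p θ) ∂lam = 1

/-- `q` is the transition density, with respect to `lam`, of a Markov kernel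
`Q(θ, dθ') = q(θ, θ') lam(dθ')`. -/
structure IsTransitionDensity {Θ : Type u} [MeasurableSpace Θ] (lam : Measure Θ)
    (q : Θ → Θ → ℝ) : Prop where
  measurable : Measurable (Function.uncurry q)
  nonneg : ∀ θ θ', 0 ≤ q θ θ'
  lintegral_eq_one : ∀ θ, ∫⁻ θ', ENNReal.ofReal (q θ θ') ∂lam = 1

/-- Metropolis-Hastings ratio `a(θ, θ') = g(θ') q(θ', θ) / (g(θ) q(θ, θ'))` for the target
density `g`, with the usual convention that it is `1` when the denominator vanishes. -/
def mhRatio {Θ : Type u} (g : Θ → ℝ) (q : Θ → Θ → ℝ) (θ θ' : Θ) : ℝ :=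
  open Classical in
  if g θ * q θ θ' = 0 then 1 else g θ' * q θ' θ / (g θ * q θ θ')

/-- Acceptance probability `1 ∧ a(θ, θ')`. -/
def mhAccept {Θ : Type u} (g : Θ → ℝ) (q : Θ → Θ → ℝ) (θ θ' : Θ) : ℝ :=
  min 1 (mhRatio g q θ θ')

/-- Probability of accepting the proposal made from `θ`. -/
def mhAcceptProb {Θ : Type u} [MeasurableSpace Θ] (lam : Measure Θ) (g : Θ → ℝ)
    (q : Θ → Θ → ℝ) (θ : Θ) : ℝ≥0∞ :=
  ∫⁻ θ', ENNReal.ofReal (q θ θ' * mhAccept g q θ θ') ∂lam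

/-- Metropolis-Hastings transition kernel with proposal density `q` and target density `g`:
`K(θ, dθ') = q(θ, θ') α(θ, θ') lam(dθ') + (1 - ∫ q(θ, t) α(θ, t) lam(dt)) δ_θ(dθ')`. -/
def mhKernel {Θ : Type u} [MeasurableSpace Θ] (lam : Measure Θ) [SFinite lam] (g : Θ → ℝ)
    (q : Θ → Θ → ℝ) : Kernel Θ Θ :=
  Kernel.withDensity (Kernel.const Θ lam)
      (fun θ θ' => ENNReal.ofReal (q θ θ' * mhAccept g q θ θ')) +
    Kernel.withDensity Kernel.id (fun θ _ => 1 - mhAcceptProb lam g q θ)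

/-- The density proportional to `p(θ) L(θ)`. -/
def posteriorDensity {Θ : Type u} [MeasurableSpace Θ] (lam : Measure Θ) (p L : Θ → ℝ) (θ : Θ) :
    ℝ :=
  p θ * L θ / ∫ t, p t * L t ∂lam

/-- The probability distribution `π(dθ) ∝ p(θ) L(θ) lam(dθ)`. -/
def posteriorMeasure {Θ : Type u} [MeasurableSpace Θ] (lam : Measure Θ) (p L : Θ → ℝ) : Measure Θ :=
  lam.withDensity fun θ => ENNReal.ofReal (posteriorDensity lam p L θ)

/-- The set of subsets of size `n` of the `N` indices. -/
abbrev Subsets (N n : ℕ) : Type := {U : Finset (Fin N) // U.card = n}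

/-- The subsample `Y_U`, its entries listed in the order of their indices. -/
def subsample {𝓨 : Type v} {N n : ℕ} (Y : Fin N → 𝓨) (U : Subsets N n) : Fin n → 𝓨 :=
  fun k => Y (U.1.orderEmbOfFin U.2 k)

/-- The scaled likelihood `f(Y_U | θ)^(N/n)` of a subsample. -/
def scaledLik {Θ : Type u} {𝓨 : Type v} {N n : ℕ} (f : (k : ℕ) → (Fin k → 𝓨) → Θ → ℝ)
    (Y : Fin N → 𝓨) (U : Subsets N n) (θ : Θ) : ℝ :=
  f n (subsample Y U) θ ^ ((N : ℝ) / (n : ℝ))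

/-- `φ_U(θ) = f(Y_U | θ)^(N/n) / f(Y | θ)`. -/
def phi {Θ : Type u} {𝓨 : Type v} {N n : ℕ} (f : (k : ℕ) → (Fin k → 𝓨) → Θ → ℝ)
    (Y : Fin N → 𝓨) (U : Subsets N n) (θ : Θ) : ℝ :=
  scaledLik f Y U θ / f N Y θ

/-- `Δ_n(U) = S(Y) - (N/n) S(Y_U)`. -/
def delta {𝓨 : Type v} {N n s : ℕ} (S : (k : ℕ) → (Fin k → 𝓨) → EuclideanSpace ℝ (Fin s))
    (Y : Fin N → 𝓨) (U : Subsets N n) : EuclideanSpace ℝ (Fin s) :=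
  S N Y - ((N : ℝ) / (n : ℝ)) • S n (subsample Y U)

/-- The normalized summary statistics `S(y) / k` of a sample of size `k`. -/
def normStat {𝓨 : Type v} {s : ℕ} (S : (k : ℕ) → (Fin k → 𝓨) → EuclideanSpace ℝ (Fin s))
    (k : ℕ) (y : Fin k → 𝓨) : EuclideanSpace ℝ (Fin s) :=
  (k : ℝ)⁻¹ • S k y

/-- The subset weights `ν_{n,ε}(U) ∝ exp(-ε ‖Δ_n(U)‖²)`. -/
def subsetWeight {𝓨 : Type v} {N n s : ℕ}
    (S : (k : ℕ) → (Fin k → 𝓨) → EuclideanSpace ℝ (Fin s))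
    (Y : Fin N → 𝓨) (ε : ℝ) (U : Subsets N n) : ℝ :=
  Real.exp (-ε * ‖delta S Y U‖ ^ 2) / ∑ V : Subsets N n, Real.exp (-ε * ‖delta S Y V‖ ^ 2)

/-- The exact Metropolis-Hastings kernel `K`, targeting `π(θ | Y) ∝ p(θ) f(Y | θ)`. -/
def exactKernel {Θ : Type u} [MeasurableSpace Θ] {𝓨 : Type v} (lam : Measure Θ) [SFinite lam]
    (p : Θ → ℝ) (q : Θ → Θ → ℝ) (f : (k : ℕ) → (Fin k → 𝓨) → Θ → ℝ) {N : ℕ}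
    (Y : Fin N → 𝓨) : Kernel Θ Θ :=
  mhKernel lam (posteriorDensity lam p (f N Y)) q

/-- The Metropolis-Hastings kernel `K(θ, · | U)`, targeting `∝ p(θ) f(Y_U | θ)^(N/n)`. -/
def subKernel {Θ : Type u} [MeasurableSpace Θ] {𝓨 : Type v} (lam : Measure Θ) [SFinite lam]
    (p : Θ → ℝ) (q : Θ → Θ → ℝ) (f : (k : ℕ) → (Fin k → 𝓨) → Θ → ℝ) {N n : ℕ}
    (Y : Fin N → 𝓨) (U : Subsets N n) : Kernel Θ Θ :=
  mhKernel lam (posteriorDensity lam p (scaledLik f Y U)) q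

/-- The transition kernel `K̃_{n,ε}(θ, A) = ∑_U ν_{n,ε}(U) K(θ, A | U)` of the marginal chain when
the subsets used at the successive iterations are i.i.d. with distribution `ν_{n,ε}`. -/
def issKernel {Θ : Type u} [MeasurableSpace Θ] {𝓨 : Type v} (lam : Measure Θ) [SFinite lam]
    (p : Θ → ℝ) (q : Θ → Θ → ℝ) (f : (k : ℕ) → (Fin k → 𝓨) → Θ → ℝ) {N : ℕ} (n : ℕ) {s : ℕ}
    (S : (k : ℕ) → (Fin k → 𝓨) → EuclideanSpace ℝ (Fin s)) (Y : Fin N → 𝓨) (ε : ℝ) :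
    Kernel Θ Θ where
  toFun θ := ∑ U : Subsets N n, ENNReal.ofReal (subsetWeight S Y ε U) • subKernel lam p q f Y U θ
  measurable' := by
    refine Measure.measurable_of_measurable_coe _ fun A hA => ?_
    simp only [Measure.coe_finsetSum, Finset.sum_apply, Measure.smul_apply, smul_eq_mul]
    exact Finset.measurable_sum _ fun U _ =>
      ((subKernel lam p q f Y U).measurable_coe hA).const_mul _

/-- Uniform ergodicity with constants `C` and `ϱ`: `sup_θ ‖π - K^i(θ, ·)‖ ≤ C ϱ^i` for all `i`. -/
def UniformlyErgodic {Θ : Type u} [MeasurableSpace Θ] (K : Kernel Θ Θ) (π : Measure Θ)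
    (C ϱ : ℝ) : Prop :=
  ∀ i : ℕ, ⨆ θ : Θ, tvDist π ((K ^ i) θ) ≤ ENNReal.ofReal (C * ϱ ^ i)

/-- Assumption on the summary statistics: there is a finite `γ` with
`|log f(Y | θ) - (N/n) log f(Y_U | θ)| ≤ γ N ‖S(Y)/N - S(Y_U)/n‖` for all `θ` and `U`. -/
def SummaryStatAssumption {Θ : Type u} {𝓨 : Type v} {N : ℕ} (n : ℕ) {s : ℕ}
    (f : (k : ℕ) → (Fin k → 𝓨) → Θ → ℝ)
    (S : (k : ℕ) → (Fin k → 𝓨) → EuclideanSpace ℝ (Fin s)) (Y : Fin N → 𝓨) : Prop :=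
  ∃ γ : ℝ, ∀ (θ : Θ) (U : Subsets N n),
    |Real.log (f N Y θ) - ((N : ℝ) / (n : ℝ)) * Real.log (f n (subsample Y U) θ)| ≤
      γ * N * ‖normStat S N Y - normStat S n (subsample Y U)‖

/-- `A_n = ∑_U ν_{n,ε}(U) sup_θ f(Y | θ) / f(Y_U | θ)^(N/n)`. -/
def constA {Θ : Type u} {𝓨 : Type v} {N : ℕ} (n : ℕ) {s : ℕ}
    (f : (k : ℕ) → (Fin k → 𝓨) → Θ → ℝ)
    (S : (k : ℕ) → (Fin k → 𝓨) → EuclideanSpace ℝ (Fin s)) (Y : Fin N → 𝓨) (ε : ℝ) : ℝ≥0∞ :=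
  ∑ U : Subsets N n, ENNReal.ofReal (subsetWeight S Y ε U) *
    ⨆ θ : Θ, ENNReal.ofReal (f N Y θ / scaledLik f Y U θ)

/-- `B_n(θ, U) = ∫ Q(θ, dθ') a(θ, θ') |φ_U(θ) - φ_U(θ')|`, with `a` the ratio of the exact
Metropolis-Hastings algorithm. -/
def constB {Θ : Type u} [MeasurableSpace Θ] {𝓨 : Type v} (lam : Measure Θ)
    (p : Θ → ℝ) (q : Θ → Θ → ℝ) (f : (k : ℕ) → (Fin k → 𝓨) → Θ → ℝ) {N n : ℕ}
    (Y : Fin N → 𝓨) (θ : Θ) (U : Subsets N n) : ℝ≥0∞ :=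
  ∫⁻ θ', ENNReal.ofReal (q θ θ' * (mhRatio (posteriorDensity lam p (f N Y)) q θ θ' *
    |phi f Y U θ - phi f Y U θ'|)) ∂lam

end ISSMCMC

end

/-!
The exact chain `K` forgets its starting point geometrically fast, so replacing its steps one at a
time by steps of the subsampled chain `K̃` costs in total at most the one-step distance times the
sum of the oscillations of `K^j`, that is `2 C / (1 - ϱ)` times the one-step distance
(`pow_le_pow_add_sum`, `sum_two_mul_ofReal_geometric_le`). Throughout, a total variation bound
between probability measures is used in the equivalent one-sided form `μ A ≤ ν A + d` for all
measurable `A`, which allows all estimates to be made in `ℝ≥0∞`.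

The one-step distance is estimated one subset at a time. The subsample posterior is the exact
posterior reweighted by `φ_U`, so its acceptance ratio is `φ_U(θ') / φ_U(θ)` times the exact one,
and two Metropolis-Hastings kernels with the same proposal differ by at most the mean difference of
their acceptance probabilities (`mhKernel_reweight_le_add`). Averaging over subsets gives
`A_n sup B_n` (`issKernel_le_add`).

The limit in the second claim exists because the worst-case distance to any fixed probability
measure decreases along the iterates (`antitone_iSup_tvDist_pow`). No ergodicity of `K̃` is needed,
and indeed `K̃` may be periodic.

For the existence of an invariant probability measure, the assumption on the summary statistics
bounds `φ_U` away from `0` and `∞`, so the lazy chain `(I + K̃) / 2` dominates a positive multiple of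
`K` (`exists_mul_exactKernel_le_lazyKernel`). A power of the lazy chain is then a strict contraction
in total variation, and the lazy chain has an invariant law (`exists_invariant_of_dominates`), which
is also invariant for `K̃`. Any invariant law is within the perturbation bound of `π`, by averaging
the bound for `K̃^i` over it and letting `i` tend to infinity.
-/

namespace ISSMCMC

/-! ### Total variation distance -/

section TotalVariation

variable {Θ : Type u} [MeasurableSpace Θ] {μ ν : Measure Θ} {d : ℝ≥0∞}

/-- For probability measures a one-sided bound on all measurable sets is automatically two-sided,
by passing to complements. -/
lemma measure_le_add_symm [IsProbabilityMeasure μ] [IsProbabilityMeasure ν]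
    (h : ∀ A, MeasurableSet A → μ A ≤ ν A + d) (A : Set Θ) (hA : MeasurableSet A) :
    ν A ≤ μ A + d := by
  have h1 := h Aᶜ hA.compl
  have h2 : ν A + ν Aᶜ = 1 := prob_add_prob_compl hA
  have h3 : μ A + μ Aᶜ = 1 := prob_add_prob_compl hA
  refine (ENNReal.add_le_add_iff_right (measure_ne_top ν Aᶜ)).1 ?_
  calc ν A + ν Aᶜ = μ A + μ Aᶜ := by rw [h2, h3]
    _ ≤ μ A + (ν Aᶜ + d) := by gcongr
    _ = μ A + d + ν Aᶜ := by ring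

/-- It suffices to test a two-sided bound on one of `A`, `Aᶜ`, for instance on the sets that do
not contain a given point. -/
lemma measure_le_add_of_notMem [IsProbabilityMeasure μ] [IsProbabilityMeasure ν] (θ : Θ)
    (h : ∀ A, MeasurableSet A → θ ∉ A → μ A ≤ ν A + d)
    (h' : ∀ A, MeasurableSet A → θ ∉ A → ν A ≤ μ A + d) (A : Set Θ) (hA : MeasurableSet A) :
    μ A ≤ ν A + d := by
  by_cases hθ : θ ∈ A
  · have h1 := h' Aᶜ hA.compl (by simpa using hθ)
    have h2 : ν A + ν Aᶜ = 1 := prob_add_prob_compl hA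
    have h3 : μ A + μ Aᶜ = 1 := prob_add_prob_compl hA
    refine (ENNReal.add_le_add_iff_right (measure_ne_top μ Aᶜ)).1 ?_
    calc μ A + μ Aᶜ = ν A + ν Aᶜ := by rw [h2, h3]
      _ ≤ ν A + (μ Aᶜ + d) := by gcongr
      _ = ν A + d + μ Aᶜ := by ring
  · exact h A hA hθ

lemma tvDist_le [IsProbabilityMeasure μ] [IsProbabilityMeasure ν]
    (h : ∀ A, MeasurableSet A → μ A ≤ ν A + d) : tvDist μ ν ≤ d := by
  refine iSup₂_le fun A hA => ?_
  rcases eq_or_ne d ∞ with rfl | hd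
  · exact le_top
  have key : ∀ {μ ν : Measure Θ} [IsProbabilityMeasure μ] [IsProbabilityMeasure ν],
      μ A ≤ ν A + d → μ.real A ≤ ν.real A + d.toReal := fun {μ ν} _ _ h => by
    rw [Measure.real, Measure.real, ← ENNReal.toReal_add (measure_ne_top ν A) hd]
    exact ENNReal.toReal_mono (by finiteness) h
  have h1 := key (h A hA)
  have h2 := key (measure_le_add_symm h A hA)
  exact ENNReal.ofReal_le_of_le_toReal (abs_le.2 ⟨by linarith, by linarith⟩)

lemma measure_le_add_tvDist (μ ν : Measure Θ) [IsFiniteMeasure μ] [IsFiniteMeasure ν] {A : Set Θ}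
    (hA : MeasurableSet A) : μ A ≤ ν A + tvDist μ ν := by
  have h : ENNReal.ofReal |μ.real A - ν.real A| ≤ tvDist μ ν :=
    le_iSup₂ (f := fun (A : Set Θ) (_ : MeasurableSet A) =>
      ENNReal.ofReal |μ.real A - ν.real A|) A hA
  calc μ A = ENNReal.ofReal (μ.real A) := (ofReal_measureReal).symm
    _ ≤ ENNReal.ofReal (ν.real A + |μ.real A - ν.real A|) :=
        ENNReal.ofReal_le_ofReal (by linarith [le_abs_self (μ.real A - ν.real A)])
    _ = ν A + ENNReal.ofReal |μ.real A - ν.real A| := by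
        rw [ENNReal.ofReal_add measureReal_nonneg (abs_nonneg _), ofReal_measureReal]
    _ ≤ ν A + tvDist μ ν := by gcongr

lemma tvDist_comm (μ ν : Measure Θ) : tvDist μ ν = tvDist ν μ := by
  simp only [tvDist, abs_sub_comm]

/-- Layer-cake form of the duality between total variation and bounded functions. -/
lemma lintegral_le_add_mul (h : ∀ A, MeasurableSet A → μ A ≤ ν A + d) {g : Θ → ℝ≥0∞}
    (hg : Measurable g) {M : ℝ≥0∞} (hM : M ≠ ∞) (hgM : ∀ x, g x ≤ M) :
    ∫⁻ x, g x ∂μ ≤ ∫⁻ x, g x ∂ν + M * d := by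
  have hofReal : ∀ x, ENNReal.ofReal (g x).toReal = g x := fun x =>
    ENNReal.ofReal_toReal (ne_top_of_le_ne_top hM (hgM x))
  have cake : ∀ ρ : Measure Θ,
      ∫⁻ x, g x ∂ρ = ∫⁻ t in Set.Ioi (0 : ℝ), ρ {x | t < (g x).toReal} := fun ρ => by
    rw [← lintegral_eq_lintegral_meas_lt ρ (ae_of_all _ fun x => ENNReal.toReal_nonneg)
      hg.ennreal_toReal.aemeasurable]
    simp only [hofReal]
  rw [cake, cake]
  calc ∫⁻ t in Set.Ioi (0 : ℝ), μ {x | t < (g x).toReal}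
      ≤ ∫⁻ t in Set.Ioi (0 : ℝ), (ν {x | t < (g x).toReal} +
          (Set.Iio M.toReal).indicator (fun _ => d) t) := by
        refine lintegral_mono fun t => ?_
        by_cases ht : t < M.toReal
        · simpa [Set.indicator, ht] using
            h _ (measurableSet_lt measurable_const hg.ennreal_toReal)
        · have : {x | t < (g x).toReal} = ∅ := by
            ext x
            simpa using (ENNReal.toReal_mono hM (hgM x)).trans (not_lt.1 ht)
          simp [this]
    _ = _ := by
        rw [lintegral_add_right _ (measurable_const.indicator measurableSet_Iio),
          lintegral_indicator measurableSet_Iio, setLIntegral_const,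
          Measure.restrict_apply measurableSet_Iio, Set.inter_comm, Set.Ioi_inter_Iio,
          Real.volume_Ioo, sub_zero, ENNReal.ofReal_toReal hM, mul_comm d]

/-- Averages of `g` under two probability measures differ by at most the oscillation of `g` times
their total variation distance. -/
lemma lintegral_le_add_osc_mul [IsProbabilityMeasure μ] [IsProbabilityMeasure ν]
    (h : ∀ A, MeasurableSet A → μ A ≤ ν A + d) {g : Θ → ℝ≥0∞} (hg : Measurable g)
    {M : ℝ≥0∞} (hM : M ≠ ∞) (hosc : ∀ x y, g x ≤ g y + M) :
    ∫⁻ x, g x ∂μ ≤ ∫⁻ x, g x ∂ν + M * d := by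
  have : Nonempty Θ := nonempty_of_isProbabilityMeasure μ
  set m := ⨅ y, g y with hm
  have hle : ∀ x, m ≤ g x := fun x => iInf_le _ x
  have hsub : ∀ x, g x - m ≤ M := fun x => by
    rw [tsub_le_iff_left, hm, ENNReal.iInf_add]
    exact le_iInf fun y => hosc x y
  have split : ∀ ρ : Measure Θ, IsProbabilityMeasure ρ →
      ∫⁻ x, g x ∂ρ = m + ∫⁻ x, (g x - m) ∂ρ := fun ρ _ => by
    have : ∀ x, g x = m + (g x - m) := fun x => (add_tsub_cancel_of_le (hle x)).symm
    conv_lhs => rw [lintegral_congr this]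
    rw [lintegral_add_left measurable_const, lintegral_const, measure_univ, mul_one]
  rw [split μ ‹_›, split ν ‹_›, add_assoc]
  gcongr
  exact lintegral_le_add_mul h (hg.sub_const m) hM hsub

end TotalVariation

/-! ### Perturbation and ergodicity of Markov kernels -/

section Kernels

variable {Θ : Type u} [MeasurableSpace Θ]

instance isMarkovKernel_pow (K : Kernel Θ Θ) [IsMarkovKernel K] (i : ℕ) :
    IsMarkovKernel (K ^ i) := by
  induction i with
  | zero => rw [pow_zero]; exact inferInstanceAs (IsMarkovKernel Kernel.id)
  | succ i ih => rw [pow_succ]; exact inferInstanceAs (IsMarkovKernel ((K ^ i) ∘ₖ K))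

/-- The Chapman-Kolmogorov equation that splits off the first step. -/
lemma pow_succ_apply_eq_lintegral_pow (K : Kernel Θ Θ) (i : ℕ) (θ : Θ) {A : Set Θ}
    (hA : MeasurableSet A) : (K ^ (i + 1)) θ A = ∫⁻ x, (K ^ i) x A ∂(K θ) := by
  rw [add_comm, Kernel.pow_add_apply_eq_lintegral _ _ _ _ hA, pow_one]

lemma lintegral_le_of_forall_le {μ : Measure Θ} [IsProbabilityMeasure μ] {g : Θ → ℝ≥0∞}
    {c : ℝ≥0∞} (h : ∀ x, g x ≤ c) : ∫⁻ x, g x ∂μ ≤ c :=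
  (lintegral_mono h).trans (by simp)

lemma le_lintegral_of_forall_le {μ : Measure Θ} [IsProbabilityMeasure μ] {g : Θ → ℝ≥0∞}
    {c : ℝ≥0∞} (h : ∀ x, c ≤ g x) : c ≤ ∫⁻ x, g x ∂μ :=
  le_trans (by simp) (lintegral_mono (μ := μ) h)

/-- Perturbation bound by telescoping: each replacement of one step of `K` by one step of `K'`
costs `δ`, damped by the oscillation `M j` of the remaining `j` steps of `K`. -/
lemma pow_le_pow_add_sum (K K' : Kernel Θ Θ) [IsMarkovKernel K] [IsMarkovKernel K'] {δ : ℝ≥0∞}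
    (hδ : ∀ θ A, MeasurableSet A → K' θ A ≤ K θ A + δ) {M : ℕ → ℝ≥0∞} (hM : ∀ j, M j ≠ ∞)
    (hosc : ∀ j A, MeasurableSet A → ∀ x y, (K ^ j) x A ≤ (K ^ j) y A + M j) (i : ℕ) (θ : Θ)
    (A : Set Θ) (hA : MeasurableSet A) :
    (K' ^ i) θ A ≤ (K ^ i) θ A + (∑ j ∈ Finset.range i, M j) * δ := by
  induction i generalizing θ with
  | zero => simp
  | succ i ih =>
    rw [pow_succ_apply_eq_lintegral_pow _ _ _ hA, pow_succ_apply_eq_lintegral_pow _ _ _ hA]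
    calc ∫⁻ b, (K' ^ i) b A ∂(K' θ)
        ≤ ∫⁻ b, ((K ^ i) b A + (∑ j ∈ Finset.range i, M j) * δ) ∂(K' θ) := lintegral_mono ih
      _ = ∫⁻ b, (K ^ i) b A ∂(K' θ) + (∑ j ∈ Finset.range i, M j) * δ := by
          rw [lintegral_add_right _ measurable_const, lintegral_const, measure_univ, mul_one]
      _ ≤ ∫⁻ b, (K ^ i) b A ∂(K θ) + M i * δ + (∑ j ∈ Finset.range i, M j) * δ := by
          gcongr
          exact lintegral_le_add_osc_mul (hδ θ) (Kernel.measurable_coe _ hA)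
            (hM i) (hosc i A hA)
      _ = _ := by rw [Finset.sum_range_succ]; ring

/-- The worst-case distance to a fixed probability measure, invariant or not, decreases along the
iterates: a step of the chain before the iterates only averages over starting points. -/
lemma antitone_iSup_tvDist_pow (K : Kernel Θ Θ) [IsMarkovKernel K] (π : Measure Θ)
    [IsProbabilityMeasure π] : Antitone fun i : ℕ => ⨆ θ, tvDist π ((K ^ i) θ) := by
  refine antitone_nat_of_succ_le fun i => iSup_le fun θ => ?_
  rw [tvDist_comm]
  refine tvDist_le fun A hA => ?_
  rw [pow_succ_apply_eq_lintegral_pow _ _ _ hA]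
  refine lintegral_le_of_forall_le fun x => ?_
  refine (measure_le_add_tvDist ((K ^ i) x) π hA).trans ?_
  rw [tvDist_comm]
  gcongr
  exact le_iSup (fun θ => tvDist π ((K ^ i) θ)) x

/-- If the oscillation of `θ ↦ L^i(θ, A)` tends to zero uniformly in `A`, then `L` has an invariant
probability measure, the uniform limit of the laws `L^i(θ, ·)`. -/
lemma exists_invariant_of_osc_tendsto_zero [Nonempty Θ] (L : Kernel Θ Θ) [IsMarkovKernel L]
    {t : ℕ → ℝ≥0∞} (ht : Tendsto t atTop (𝓝 0))
    (hosc : ∀ i A, MeasurableSet A → ∀ x y, (L ^ i) x A ≤ (L ^ i) y A + t i) :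
    ∃ π : Measure Θ, IsProbabilityMeasure π ∧ Kernel.Invariant L π := by
  have θ₀ : Θ := Classical.arbitrary Θ
  set m : Set Θ → ℝ≥0∞ := fun A => ⨅ i, ⨆ θ, (L ^ i) θ A with hm
  have hle : ∀ i A, MeasurableSet A → m A ≤ (L ^ i) θ₀ A + t i := fun i A hA =>
    (iInf_le _ i).trans (iSup_le fun θ => hosc i A hA θ θ₀)
  have hanti : ∀ A, MeasurableSet A → Antitone fun i => ⨆ θ, (L ^ i) θ A := fun A hA => by
    refine antitone_nat_of_succ_le fun i => iSup_le fun θ => ?_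
    rw [pow_succ_apply_eq_lintegral_pow _ _ _ hA]
    exact lintegral_le_of_forall_le fun x => le_iSup (fun θ => (L ^ i) θ A) x
  have hge : ∀ i A, MeasurableSet A → (L ^ i) θ₀ A ≤ m A + t i := fun i A hA => by
    rw [hm, ENNReal.iInf_add]
    refine le_iInf fun j => ?_
    -- Compare at time `max i j`, which is `k` steps after time `i`.
    obtain ⟨k, hk⟩ := Nat.exists_eq_add_of_le (le_max_left i j)
    calc (L ^ i) θ₀ A ≤ ∫⁻ x, ((L ^ i) x A + t i) ∂((L ^ k) θ₀) :=
          le_lintegral_of_forall_le fun x => hosc i A hA θ₀ x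
      _ = (L ^ (max i j)) θ₀ A + t i := by
          rw [lintegral_add_right _ measurable_const, lintegral_const, measure_univ, mul_one,
            hk, add_comm i, Kernel.pow_add_apply_eq_lintegral _ _ _ _ hA]
      _ ≤ (⨆ θ, (L ^ j) θ A) + t i := by
          gcongr
          exact (le_iSup (fun θ => (L ^ (max i j)) θ A) θ₀).trans
            (hanti A hA (le_max_right i j))
  have hlim : ∀ A, MeasurableSet A → Tendsto (fun i => (L ^ i) θ₀ A) atTop (𝓝 (m A)) :=
    fun A hA => by
    have hfin : m A ≠ ∞ := ne_top_of_le_ne_top ENNReal.one_ne_top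
      ((iInf_le _ 0).trans (iSup_le fun θ => prob_le_one))
    refine tendsto_of_tendsto_of_tendsto_of_le_of_le (g := fun i => m A - t i)
      (h := fun i => m A + t i) ?_ ?_ (fun i => tsub_le_iff_right.2 (hle i A hA))
      (fun i => hge i A hA)
    · simpa using ENNReal.Tendsto.sub tendsto_const_nhds ht (Or.inl hfin)
    · simpa using tendsto_const_nhds.add ht
  have hm_mono : ∀ A B, MeasurableSet A → MeasurableSet B → A ⊆ B → m A ≤ m B :=
    fun A B hA hB hAB => le_of_tendsto_of_tendsto' (hlim A hA) (hlim B hB)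
      fun i => measure_mono hAB
  have hm_fin : ∀ (A : ℕ → Set Θ), (∀ k, MeasurableSet (A k)) → Pairwise (Function.onFun Disjoint A)
      → ∀ n, m (⋃ k ∈ Finset.range n, A k) = ∑ k ∈ Finset.range n, m (A k) :=
    fun A hA hdisj n => by
    refine tendsto_nhds_unique
      (hlim _ (Finset.measurableSet_biUnion _ fun k _ => hA k)) ?_
    refine (tendsto_finsetSum (Finset.range n) fun k _ => hlim (A k) (hA k)).congr fun i => ?_
    rw [measure_biUnion_finset (fun a _ b _ hab => hdisj hab) fun k _ => hA k]
  have hm_empty : m ∅ = 0 := tendsto_nhds_unique (hlim ∅ .empty) (by simp)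
  have hm_iUnion : ∀ (A : ℕ → Set Θ), (∀ k, MeasurableSet (A k)) →
      Pairwise (Function.onFun Disjoint A) → m (⋃ k, A k) = ∑' k, m (A k) := fun A hA hdisj => by
    refine le_antisymm ?_ ?_
    · -- Uniformity in the set turns countable additivity of the iterates into that of the limit.
      have h2 : ∀ i, m (⋃ k, A k) ≤ ∑' k, m (A k) + t i + t i := fun i => by
        refine (hle i _ (MeasurableSet.iUnion hA)).trans ?_
        gcongr
        rw [measure_iUnion hdisj hA, ENNReal.tsum_eq_iSup_nat]
        refine iSup_le fun n => ?_
        rw [← measure_biUnion_finset (fun a _ b _ hab => hdisj hab) fun k _ => hA k]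
        refine (hge i _ (Finset.measurableSet_biUnion _ fun k _ => hA k)).trans ?_
        rw [hm_fin A hA hdisj]
        gcongr
        exact ENNReal.sum_le_tsum _
      refine ge_of_tendsto' (?_ : Tendsto (fun i => ∑' k, m (A k) + t i + t i) atTop _) h2
      simpa using (tendsto_const_nhds.add ht).add ht
    · rw [ENNReal.tsum_eq_iSup_nat]
      refine iSup_le fun n => ?_
      rw [← hm_fin A hA hdisj]
      exact hm_mono _ _ (Finset.measurableSet_biUnion _ fun k _ => hA k) (MeasurableSet.iUnion hA)
        (Set.iUnion₂_subset fun k _ => Set.subset_iUnion A k)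
  let π : Measure Θ := Measure.ofMeasurable (fun A _ => m A) hm_empty
    fun A hA hdisj => hm_iUnion A hA hdisj
  have hπ : ∀ A, MeasurableSet A → π A = m A := fun A hA => Measure.ofMeasurable_apply A hA
  have hprob : IsProbabilityMeasure π := ⟨by
    rw [hπ _ .univ]
    exact tendsto_nhds_unique (hlim _ .univ) (by simp)⟩
  refine ⟨π, hprob, ?_⟩
  have hbind : ∀ A, MeasurableSet A → π.bind L A ≤ π A + 0 := fun A hA => by
    rw [Measure.bind_apply hA L.aemeasurable]
    have h1 : ∀ i, ∫⁻ x, L x A ∂π ≤ π A + t (i + 1) + t i := fun i => by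
      calc ∫⁻ x, L x A ∂π ≤ ∫⁻ x, L x A ∂((L ^ i) θ₀) + 1 * t i :=
            lintegral_le_add_mul (fun B hB => by rw [hπ B hB]; exact hle i B hB)
              (L.measurable_coe hA) ENNReal.one_ne_top fun x => prob_le_one
        _ = (L ^ (i + 1)) θ₀ A + t i := by
            rw [Kernel.pow_add_apply_eq_lintegral _ _ _ _ hA, pow_one, one_mul]
        _ ≤ π A + t (i + 1) + t i := by
            gcongr
            rw [hπ A hA]
            exact hge _ A hA
    refine ge_of_tendsto' (?_ : Tendsto (fun i => π A + t (i + 1) + t i) atTop _) h1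
    have ht1 : Tendsto (fun i => t (i + 1)) atTop (𝓝 0) := (tendsto_add_atTop_iff_nat 1).2 ht
    simpa using (tendsto_const_nhds.add ht1).add ht
  have : IsProbabilityMeasure (π.bind L) := inferInstance
  refine Measure.ext fun A hA => le_antisymm (by simpa using hbind A hA) ?_
  simpa using measure_le_add_symm hbind A hA

/-- Dobrushin contraction: if `L^m` has contraction coefficient `τ`, then the oscillation of
`L^i(·, A)` is at most `τ^⌊i/m⌋`. -/
lemma osc_pow_le (L : Kernel Θ Θ) [IsMarkovKernel L] {m : ℕ} {τ : ℝ≥0∞}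
    (hτ : τ ≠ ∞) (h : ∀ x y A, MeasurableSet A → (L ^ m) x A ≤ (L ^ m) y A + τ) (i : ℕ) (A : Set Θ)
    (hA : MeasurableSet A) (x y : Θ) : (L ^ i) x A ≤ (L ^ i) y A + τ ^ (i / m) := by
  have key : ∀ k r x y, (L ^ (r + k * m)) x A ≤ (L ^ (r + k * m)) y A + τ ^ k := fun k r => by
    induction k with
    | zero => exact fun x y => by simpa using prob_le_one.trans (by simp)
    | succ k ih =>
      intro x y
      have e : r + (k + 1) * m = m + (r + k * m) := by ring
      rw [e, Kernel.pow_add_apply_eq_lintegral _ _ _ _ hA,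
        Kernel.pow_add_apply_eq_lintegral _ _ _ _ hA, pow_succ]
      exact lintegral_le_add_osc_mul (h x y) (Kernel.measurable_coe _ hA)
        (ENNReal.pow_ne_top hτ) ih
  have := key (i / m) (i % m) x y
  rwa [mul_comm, Nat.mod_add_div] at this

lemma pow_le_pow_of_le (K L : Kernel Θ Θ) {c : ℝ≥0∞}
    (h : ∀ θ A, MeasurableSet A → c * K θ A ≤ L θ A) (i : ℕ) (θ : Θ) (A : Set Θ)
    (hA : MeasurableSet A) : c ^ i * (K ^ i) θ A ≤ (L ^ i) θ A := by
  induction i generalizing θ with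
  | zero => simp
  | succ i ih =>
    rw [pow_succ_apply_eq_lintegral_pow _ _ _ hA, pow_succ_apply_eq_lintegral_pow _ _ _ hA]
    have hle : c • K θ ≤ L θ := Measure.le_iff.2 fun B hB => by simpa using h θ B hB
    calc c ^ (i + 1) * ∫⁻ b, (K ^ i) b A ∂(K θ)
        = ∫⁻ b, c ^ i * (K ^ i) b A ∂(c • K θ) := by
          rw [lintegral_smul_measure, lintegral_const_mul _ (Kernel.measurable_coe _ hA), pow_succ,
            smul_eq_mul]
          ring
      _ ≤ ∫⁻ b, (L ^ i) b A ∂(L θ) := lintegral_mono' hle ih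

/-- Overlap of the laws `K^m(x, ·)` for large `m` is inherited, up to the factor `c^m`, by the laws
`L^m(x, ·)`, so that `L^m` is a contraction in total variation. -/
lemma exists_invariant_of_dominates [Nonempty Θ] (K L : Kernel Θ Θ) [IsMarkovKernel K]
    [IsMarkovKernel L] {π : Measure Θ} [IsProbabilityMeasure π] {C ϱ : ℝ} (hϱ0 : 0 < ϱ)
    (hϱ1 : ϱ < 1) (hK : UniformlyErgodic K π C ϱ) {c : ℝ≥0∞} (hc0 : c ≠ 0)
    (h : ∀ θ A, MeasurableSet A → c * K θ A ≤ L θ A) :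
    ∃ π' : Measure Θ, IsProbabilityMeasure π' ∧ Kernel.Invariant L π' := by
  -- After `m` steps all laws of `K` are within `1/4` of `π`, hence within `1/2` of each other.
  obtain ⟨m, hm, hm0⟩ : ∃ m : ℕ, C * ϱ ^ m ≤ 1 / 4 ∧ m ≠ 0 := by
    have : Tendsto (fun m : ℕ => C * ϱ ^ m) atTop (𝓝 (C * 0)) :=
      (tendsto_pow_atTop_nhds_zero_of_lt_one hϱ0.le hϱ1).const_mul C
    rw [mul_zero] at this
    exact ((this.eventually (eventually_le_nhds (by norm_num))).and (eventually_ne_atTop 0)).exists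
  have hpi : ∀ θ A, MeasurableSet A → π A ≤ (K ^ m) θ A + ENNReal.ofReal (1 / 4) := fun θ A hA => by
    refine (measure_le_add_tvDist π ((K ^ m) θ) hA).trans ?_
    gcongr
    exact (le_iSup (fun θ => tvDist π ((K ^ m) θ)) θ).trans
      ((hK m).trans (ENNReal.ofReal_le_ofReal hm))
  have hhalf : ∀ x y A, MeasurableSet A → ENNReal.ofReal (1 / 2) ≤ (K ^ m) y A + (K ^ m) x Aᶜ :=
    fun x y A hA => by
    have e : ENNReal.ofReal (1 / 2) + ENNReal.ofReal (1 / 2) = 1 := by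
      rw [← ENNReal.ofReal_add (by norm_num) (by norm_num)]; norm_num
    have e' : ENNReal.ofReal (1 / 2) = ENNReal.ofReal (1 / 4) + ENNReal.ofReal (1 / 4) := by
      rw [← ENNReal.ofReal_add (by norm_num) (by norm_num)]; norm_num
    refine (ENNReal.add_le_add_iff_right (ENNReal.ofReal_ne_top (r := 1 / 2))).1 ?_
    calc ENNReal.ofReal (1 / 2) + ENNReal.ofReal (1 / 2) = π A + π Aᶜ := by
          rw [e, prob_add_prob_compl hA]
      _ ≤ ((K ^ m) y A + ENNReal.ofReal (1 / 4)) + ((K ^ m) x Aᶜ + ENNReal.ofReal (1 / 4)) :=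
          add_le_add (hpi y A hA) (hpi x Aᶜ hA.compl)
      _ = _ := by rw [e']; ring
  set η : ℝ≥0∞ := c ^ m * ENNReal.ofReal (1 / 2) with hη
  have hη0 : η ≠ 0 := mul_ne_zero (pow_ne_zero _ hc0) (by simp)
  have hcontr : ∀ x y A, MeasurableSet A → (L ^ m) x A ≤ (L ^ m) y A + (1 - η) :=
    fun x y A hA => by
    have h1 : η ≤ (L ^ m) y A + (L ^ m) x Aᶜ := by
      calc η ≤ c ^ m * ((K ^ m) y A + (K ^ m) x Aᶜ) := by
            rw [hη]; gcongr; exact hhalf x y A hA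
        _ = c ^ m * (K ^ m) y A + c ^ m * (K ^ m) x Aᶜ := mul_add _ _ _
        _ ≤ _ := add_le_add (pow_le_pow_of_le K L h m y A hA)
            (pow_le_pow_of_le K L h m x Aᶜ hA.compl)
    refine (ENNReal.add_le_add_iff_right (measure_ne_top ((L ^ m) x) Aᶜ)).1 ?_
    calc (L ^ m) x A + (L ^ m) x Aᶜ = 1 := prob_add_prob_compl hA
      _ ≤ η + (1 - η) := le_add_tsub
      _ ≤ ((L ^ m) y A + (L ^ m) x Aᶜ) + (1 - η) := by gcongr
      _ = _ := by ring
  have hτ1 : 1 - η < 1 := ENNReal.sub_lt_self ENNReal.one_ne_top one_ne_zero hη0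
  exact exists_invariant_of_osc_tendsto_zero L
    ((ENNReal.tendsto_pow_atTop_nhds_zero_of_lt_one hτ1).comp
      (Nat.tendsto_div_const_atTop hm0)) fun i A hA x y =>
      osc_pow_le L (ne_top_of_lt hτ1) hcontr i A hA x y

/-- The lazy version `(I + K) / 2` of a kernel. -/
noncomputable def lazyKernel (K : Kernel Θ Θ) : Kernel Θ Θ where
  toFun θ := (2⁻¹ : ℝ≥0∞) • Measure.dirac θ + (2⁻¹ : ℝ≥0∞) • K θ
  measurable' := by
    refine Measure.measurable_of_measurable_coe _ fun A hA => ?_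
    simp only [Measure.add_apply, Measure.smul_apply, smul_eq_mul]
    exact ((Measure.measurable_coe hA).comp Measure.measurable_dirac).const_mul _ |>.add
      ((K.measurable_coe hA).const_mul _)

lemma lazyKernel_apply (K : Kernel Θ Θ) (θ : Θ) (A : Set Θ) :
    lazyKernel K θ A = 2⁻¹ * Measure.dirac θ A + 2⁻¹ * K θ A := rfl

instance (K : Kernel Θ Θ) [IsMarkovKernel K] : IsMarkovKernel (lazyKernel K) :=
  ⟨fun θ => ⟨by rw [lazyKernel_apply]; simp [ENNReal.inv_two_add_inv_two]⟩⟩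

lemma Invariant.of_lazyKernel {K : Kernel Θ Θ} {π : Measure Θ} [IsFiniteMeasure π]
    (h : Kernel.Invariant (lazyKernel K) π) : Kernel.Invariant K π := by
  refine Measure.ext fun A hA => ?_
  have h1 : π.bind (lazyKernel K) A = π A := by rw [h.def]
  rw [Measure.bind_apply hA (lazyKernel K).aemeasurable] at h1
  rw [Measure.bind_apply hA K.aemeasurable]
  simp only [lazyKernel_apply] at h1
  have hdirac : Measurable fun θ : Θ => Measure.dirac θ A :=
    (Measure.measurable_coe hA).comp Measure.measurable_dirac
  rw [lintegral_add_left (hdirac.const_mul _), lintegral_const_mul _ hdirac,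
    lintegral_const_mul _ (K.measurable_coe hA), ← Measure.bind_apply hA
      Measure.measurable_dirac.aemeasurable, Measure.bind_dirac] at h1
  have h2 : 2⁻¹ * π A + 2⁻¹ * ∫⁻ x, K x A ∂π = 2⁻¹ * π A + 2⁻¹ * π A := by
    rw [h1, ← add_mul, ENNReal.inv_two_add_inv_two, one_mul]
  have h3 := (ENNReal.add_right_inj (by finiteness)).1 h2
  exact (ENNReal.mul_right_inj (by simp) (by simp)).1 h3

lemma Invariant.pow {K : Kernel Θ Θ} {π : Measure Θ} (h : Kernel.Invariant K π) (i : ℕ) :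
    Kernel.Invariant (K ^ i) π := by
  induction i with
  | zero =>
    rw [pow_zero]
    exact Measure.bind_dirac
  | succ i ih => rw [pow_succ]; exact ih.comp h

end Kernels

/-! ### Metropolis-Hastings kernels with reweighted targets -/

section MetropolisHastings

variable {Θ : Type u} {g g' : Θ → ℝ} {q : Θ → Θ → ℝ}

lemma mhRatio_nonneg (hg : ∀ θ, 0 ≤ g θ) (hq : ∀ θ θ', 0 ≤ q θ θ') (θ θ' : Θ) :
    0 ≤ mhRatio g q θ θ' := by
  unfold mhRatio
  split_ifs
  · exact zero_le_one
  · exact div_nonneg (mul_nonneg (hg _) (hq _ _)) (mul_nonneg (hg _) (hq _ _))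

lemma mhAccept_nonneg (hg : ∀ θ, 0 ≤ g θ) (hq : ∀ θ θ', 0 ≤ q θ θ') (θ θ' : Θ) :
    0 ≤ mhAccept g q θ θ' :=
  le_min zero_le_one (mhRatio_nonneg hg hq θ θ')

lemma mhAccept_le_one (θ θ' : Θ) : mhAccept g q θ θ' ≤ 1 := min_le_left _ _

/-- When the target is reweighted by a positive function `w`, either the ratio is `1` for both
targets by convention, or it is multiplied by `w θ' / w θ`. -/
lemma mhRatio_reweight {w : Θ → ℝ} {r : ℝ} (hr : 0 < r) (hw : ∀ θ, 0 < w θ)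
    (hg' : ∀ θ, g' θ = r * (w θ * g θ)) (θ θ' : Θ) :
    (mhRatio g q θ θ' = 1 ∧ mhRatio g' q θ θ' = 1) ∨
      mhRatio g' q θ θ' = w θ' / w θ * mhRatio g q θ θ' := by
  have hwθ := (hw θ).ne'
  have hr0 := hr.ne'
  by_cases h : g θ * q θ θ' = 0
  · have h' : g' θ * q θ θ' = 0 := by
      rw [hg', show r * (w θ * g θ) * q θ θ' = r * w θ * (g θ * q θ θ') by ring, h, mul_zero]
    exact Or.inl ⟨by simp [mhRatio, h], by simp [mhRatio, h']⟩
  · obtain ⟨h1, h2⟩ := mul_ne_zero_iff.1 h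
    have h' : ¬ g' θ * q θ θ' = 0 := by
      rw [hg']
      exact mul_ne_zero (mul_ne_zero hr0 (mul_ne_zero hwθ h1)) h2
    right
    rw [mhRatio, mhRatio, if_neg h', if_neg h, hg', hg']
    field_simp

lemma abs_mhAccept_sub_le {w : Θ → ℝ} {r : ℝ} (hr : 0 < r) (hw : ∀ θ, 0 < w θ)
    (hg : ∀ θ, 0 ≤ g θ) (hq : ∀ θ θ', 0 ≤ q θ θ')
    (hg' : ∀ θ, g' θ = r * (w θ * g θ)) (θ θ' : Θ) :
    |mhAccept g q θ θ' - mhAccept g' q θ θ'| ≤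
      1 / w θ * (mhRatio g q θ θ' * |w θ - w θ'|) := by
  have hwθ := hw θ
  have ha := mhRatio_nonneg hg hq θ θ'
  have hle : |mhAccept g q θ θ' - mhAccept g' q θ θ'| ≤
      |mhRatio g q θ θ' - mhRatio g' q θ θ'| := by
    simpa [mhAccept] using abs_min_sub_min_le_max 1 (mhRatio g q θ θ') 1 (mhRatio g' q θ θ')
  refine hle.trans ?_
  rcases mhRatio_reweight (q := q) hr hw hg' θ θ' with ⟨h1, h2⟩ | h
  · rw [h1, h2, sub_self, abs_zero]
    positivity
  · rw [h, show mhRatio g q θ θ' - w θ' / w θ * mhRatio g q θ θ' =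
      (1 / w θ) * (mhRatio g q θ θ' * (w θ - w θ')) by field_simp, abs_mul, abs_mul,
      abs_of_pos (by positivity : 0 < 1 / w θ), abs_of_nonneg ha]

lemma mul_mhAccept_le {w : Θ → ℝ} {r c : ℝ} (hr : 0 < r) (hw : ∀ θ, 0 < w θ)
    (hg : ∀ θ, 0 ≤ g θ) (hq : ∀ θ θ', 0 ≤ q θ θ')
    (hg' : ∀ θ, g' θ = r * (w θ * g θ)) (hc0 : 0 ≤ c) (hc1 : c ≤ 1)
    (hcw : ∀ θ θ', c ≤ w θ' / w θ) (θ θ' : Θ) :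
    c * mhAccept g q θ θ' ≤ mhAccept g' q θ θ' := by
  have ha := mhRatio_nonneg hg hq θ θ'
  refine le_min (mul_le_one₀ hc1 (mhAccept_nonneg hg hq θ θ') (mhAccept_le_one θ θ')) ?_
  rcases mhRatio_reweight (q := q) hr hw hg' θ θ' with ⟨_, h2⟩ | h
  · rw [h2]
    exact mul_le_one₀ hc1 (mhAccept_nonneg hg hq θ θ') (mhAccept_le_one θ θ')
  · rw [h]
    exact mul_le_mul (hcw θ θ') (min_le_right _ _) (mhAccept_nonneg hg hq θ θ')
      (hc0.trans (hcw θ θ'))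

variable [MeasurableSpace Θ] {lam : Measure Θ}

lemma measurable_uncurry_mhRatio (hg : Measurable g) (hq : Measurable (Function.uncurry q)) :
    Measurable (Function.uncurry (mhRatio g q)) := by
  have hnum : Measurable fun z : Θ × Θ => g z.2 * q z.2 z.1 :=
    (hg.comp measurable_snd).mul (hq.comp measurable_swap)
  have hden : Measurable fun z : Θ × Θ => g z.1 * q z.1 z.2 :=
    (hg.comp measurable_fst).mul hq
  exact Measurable.ite (hden (measurableSet_singleton 0)) measurable_const (hnum.div hden)

lemma measurable_uncurry_mhAccept (hg : Measurable g) (hq : Measurable (Function.uncurry q)) :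
    Measurable (Function.uncurry (mhAccept g q)) :=
  measurable_const.min (measurable_uncurry_mhRatio hg hq)

lemma measurable_uncurry_mhDensity (hg : Measurable g) (hq : Measurable (Function.uncurry q)) :
    Measurable (Function.uncurry fun θ θ' => ENNReal.ofReal (q θ θ' * mhAccept g q θ θ')) :=
  (hq.mul (measurable_uncurry_mhAccept hg hq)).ennreal_ofReal

lemma measurable_mhAcceptProb [SFinite lam] (hg : Measurable g)
    (hq : Measurable (Function.uncurry q)) : Measurable (mhAcceptProb lam g q) :=
  (measurable_uncurry_mhDensity hg hq).lintegral_prod_right'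

lemma mhAcceptProb_le_one (hq : IsTransitionDensity lam q) (θ : Θ) :
    mhAcceptProb lam g q θ ≤ 1 := by
  rw [← hq.lintegral_eq_one θ]
  refine lintegral_mono fun θ' => ENNReal.ofReal_le_ofReal ?_
  exact mul_le_of_le_one_right (hq.nonneg θ θ') (mhAccept_le_one θ θ')

lemma mhKernel_apply [SFinite lam] (hg : Measurable g) (hq : Measurable (Function.uncurry q))
    (θ : Θ) (A : Set Θ) :
    mhKernel lam g q θ A =
      ∫⁻ θ' in A, ENNReal.ofReal (q θ θ' * mhAccept g q θ θ') ∂lam +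
        (1 - mhAcceptProb lam g q θ) * Measure.dirac θ A := by
  have h2 : Measurable (Function.uncurry fun (θ _ : Θ) => 1 - mhAcceptProb lam g q θ) :=
    ((measurable_mhAcceptProb hg hq).const_sub 1).comp measurable_fst
  rw [mhKernel, FunLike.coe_add, Pi.add_apply, Measure.add_apply,
    Kernel.withDensity_apply' _ (measurable_uncurry_mhDensity hg hq),
    Kernel.withDensity_apply' _ h2, Kernel.const_apply, Kernel.id_apply, setLIntegral_const]

lemma isMarkovKernel_mhKernel [SFinite lam] (hg : Measurable g)
    (hq : IsTransitionDensity lam q) : IsMarkovKernel (mhKernel lam g q) := by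
  refine ⟨fun θ => ⟨?_⟩⟩
  rw [mhKernel_apply hg hq.measurable θ, measure_univ, mul_one, Measure.restrict_univ]
  exact add_tsub_cancel_of_le (mhAcceptProb_le_one hq θ)

lemma mhKernel_apply_of_notMem [SFinite lam] (hg : Measurable g)
    (hq : Measurable (Function.uncurry q)) {θ : Θ} {A : Set Θ} (hA : MeasurableSet A)
    (hθ : θ ∉ A) :
    mhKernel lam g q θ A = ∫⁻ θ' in A, ENNReal.ofReal (q θ θ' * mhAccept g q θ θ') ∂lam := by
  rw [mhKernel_apply hg hq θ, Measure.dirac_apply' θ hA]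
  simp [hθ]

/-- Two Metropolis-Hastings kernels with the same proposal differ by at most the average difference
of their acceptance probabilities: rejections only contribute on sets containing the current state,
whose complements do not. -/
lemma mhKernel_le_add [SFinite lam] (hg : Measurable g) (hg' : Measurable g')
    (hq : IsTransitionDensity lam q) (θ : Θ) (A : Set Θ) (hA : MeasurableSet A) :
    mhKernel lam g' q θ A ≤ mhKernel lam g q θ A +
      ∫⁻ θ', ENNReal.ofReal (q θ θ' * |mhAccept g q θ θ' - mhAccept g' q θ θ'|) ∂lam := by
  have := isMarkovKernel_mhKernel hg hq
  have := isMarkovKernel_mhKernel hg' hq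
  have key : ∀ {h h' : Θ → ℝ}, Measurable h → Measurable h' → ∀ B, MeasurableSet B → θ ∉ B →
      mhKernel lam h' q θ B ≤ mhKernel lam h q θ B +
        ∫⁻ θ', ENNReal.ofReal (q θ θ' * |mhAccept h q θ θ' - mhAccept h' q θ θ'|) ∂lam := by
    intro h h' hh hh' B hB hθ
    rw [mhKernel_apply_of_notMem hh' hq.measurable hB hθ,
      mhKernel_apply_of_notMem hh hq.measurable hB hθ]
    have hmeas : Measurable fun θ' => ENNReal.ofReal (q θ θ' * mhAccept h q θ θ') :=
      (measurable_uncurry_mhDensity hh hq.measurable).of_uncurry_left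
    calc ∫⁻ θ' in B, ENNReal.ofReal (q θ θ' * mhAccept h' q θ θ') ∂lam
        ≤ ∫⁻ θ' in B, (ENNReal.ofReal (q θ θ' * mhAccept h q θ θ') +
            ENNReal.ofReal (q θ θ' * |mhAccept h q θ θ' - mhAccept h' q θ θ'|)) ∂lam := by
          refine lintegral_mono fun θ' => ?_
          refine (ENNReal.ofReal_le_ofReal ?_).trans ENNReal.ofReal_add_le
          rw [← mul_add]
          refine mul_le_mul_of_nonneg_left ?_ (hq.nonneg θ θ')
          linarith [neg_abs_le (mhAccept h q θ θ' - mhAccept h' q θ θ')]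
      _ = ∫⁻ θ' in B, ENNReal.ofReal (q θ θ' * mhAccept h q θ θ') ∂lam +
            ∫⁻ θ' in B, ENNReal.ofReal
              (q θ θ' * |mhAccept h q θ θ' - mhAccept h' q θ θ'|) ∂lam :=
          lintegral_add_left hmeas _
      _ ≤ _ := by
          gcongr
          exact Measure.restrict_le_self
  refine measure_le_add_of_notMem θ (key hg hg') (fun B hB hθ => ?_) A hA
  simpa only [abs_sub_comm] using key hg' hg B hB hθ

lemma mhKernel_reweight_le_add [SFinite lam] (hgm : Measurable g) (hgm' : Measurable g')
    (hg : ∀ θ, 0 ≤ g θ) (hq : IsTransitionDensity lam q) {w : Θ → ℝ} {r : ℝ} (hr : 0 < r)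
    (hw : ∀ θ, 0 < w θ) (hg' : ∀ θ, g' θ = r * (w θ * g θ)) (θ : Θ) (A : Set Θ)
    (hA : MeasurableSet A) :
    mhKernel lam g' q θ A ≤ mhKernel lam g q θ A + ENNReal.ofReal (1 / w θ) *
      ∫⁻ θ', ENNReal.ofReal (q θ θ' * (mhRatio g q θ θ' * |w θ - w θ'|)) ∂lam := by
  refine (mhKernel_le_add hgm hgm' hq θ A hA).trans ?_
  gcongr
  rw [← lintegral_const_mul' _ _ ENNReal.ofReal_ne_top]
  refine lintegral_mono fun θ' => ?_
  rw [← ENNReal.ofReal_mul (one_div_nonneg.2 (hw θ).le), mul_left_comm]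
  exact ENNReal.ofReal_le_ofReal (mul_le_mul_of_nonneg_left
    (abs_mhAccept_sub_le hr hw hg hq.nonneg hg' θ θ') (hq.nonneg θ θ'))

/-- The lazy version of the kernel with the reweighted target dominates a multiple of the original
kernel. Laziness is needed: reweighting may remove the rejections of the original chain. -/
lemma mul_mhKernel_le_lazy [SFinite lam] (hgm : Measurable g) (hgm' : Measurable g')
    (hg : ∀ θ, 0 ≤ g θ) (hq : IsTransitionDensity lam q) {w : Θ → ℝ} {r c : ℝ} (hr : 0 < r)
    (hw : ∀ θ, 0 < w θ) (hg' : ∀ θ, g' θ = r * (w θ * g θ)) (hc0 : 0 ≤ c) (hc1 : c ≤ 1)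
    (hcw : ∀ θ θ', c ≤ w θ' / w θ) (θ : Θ) (A : Set Θ) :
    ENNReal.ofReal c * mhKernel lam g q θ A ≤
      Measure.dirac θ A + mhKernel lam g' q θ A := by
  rw [mhKernel_apply hgm hq.measurable θ, mhKernel_apply hgm' hq.measurable θ, mul_add,
    add_comm (Measure.dirac θ A), ← lintegral_const_mul' _ _ ENNReal.ofReal_ne_top]
  refine add_le_add (le_add_right (lintegral_mono fun θ' => ?_)) ?_
  · rw [← ENNReal.ofReal_mul hc0, mul_left_comm]
    exact ENNReal.ofReal_le_ofReal (mul_le_mul_of_nonneg_left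
      (mul_mhAccept_le hr hw hg hq.nonneg hg' hc0 hc1 hcw θ θ') (hq.nonneg θ θ'))
  · rw [← mul_assoc]
    refine mul_le_of_le_one_left' ?_
    exact mul_le_one' (by simpa using ENNReal.ofReal_le_ofReal hc1) tsub_le_self

end MetropolisHastings

/-! ### Posteriors and subset weights -/

section Likelihood

variable {Θ : Type u} {𝓨 : Type v} {N n s : ℕ} {f : (k : ℕ) → (Fin k → 𝓨) → Θ → ℝ} {Y : Fin N → 𝓨}
  {S : (k : ℕ) → (Fin k → 𝓨) → EuclideanSpace ℝ (Fin s)}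

lemma scaledLik_pos (hfU : ∀ (θ : Θ) (U : Subsets N n), 0 < f n (subsample Y U) θ)
    (U : Subsets N n) (θ : Θ) : 0 < scaledLik f Y U θ :=
  Real.rpow_pos_of_pos (hfU θ U) _

/-- The assumption on the summary statistics bounds all `φ_U` above and below by positive
constants. -/
lemma exists_exp_bound_phi (hfY : ∀ θ, 0 < f N Y θ)
    (hfU : ∀ (θ : Θ) (U : Subsets N n), 0 < f n (subsample Y U) θ)
    (hS : SummaryStatAssumption n f S Y) :
    ∃ c : ℝ, 0 ≤ c ∧ ∀ (U : Subsets N n) (θ : Θ),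
      Real.exp (-c) ≤ phi f Y U θ ∧ phi f Y U θ ≤ Real.exp c := by
  obtain ⟨γ, hγ⟩ := hS
  set b : Subsets N n → ℝ := fun U =>
    |γ * N * ‖normStat S N Y - normStat S n (subsample Y U)‖| with hb
  refine ⟨∑ U, b U, Finset.sum_nonneg fun U _ => abs_nonneg _, fun U θ => ?_⟩
  have hφ : 0 < phi f Y U θ := div_pos (scaledLik_pos hfU U θ) (hfY θ)
  have hlog : Real.log (phi f Y U θ) =
      (N : ℝ) / n * Real.log (f n (subsample Y U) θ) - Real.log (f N Y θ) := by
    rw [phi, Real.log_div (scaledLik_pos hfU U θ).ne' (hfY θ).ne', scaledLik,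
      Real.log_rpow (hfU θ U)]
  have hle : |Real.log (phi f Y U θ)| ≤ ∑ U, b U := by
    rw [hlog, abs_sub_comm]
    exact (hγ θ U).trans ((le_abs_self _).trans
      (Finset.single_le_sum (f := b) (fun V _ => abs_nonneg _) (Finset.mem_univ U)))
  obtain ⟨h1, h2⟩ := abs_le.1 hle
  exact ⟨(Real.le_log_iff_exp_le hφ).1 h1, (Real.log_le_iff_le_exp hφ).1 h2⟩

end Likelihood

section Posterior

variable {Θ : Type u} [MeasurableSpace Θ] {lam : Measure Θ} {p L : Θ → ℝ}

lemma integral_prior_mul_pos (hp : IsProbDensity lam p) (hL : ∀ θ, 0 < L θ)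
    (hint : Integrable (fun θ => p θ * L θ) lam) : 0 < ∫ t, p t * L t ∂lam := by
  have h0 : 0 ≤ fun θ => p θ * L θ := fun θ => mul_nonneg (hp.nonneg θ) (hL θ).le
  refine (integral_pos_iff_support_of_nonneg h0 hint).2 (pos_iff_ne_zero.2 fun hz => ?_)
  have hsupp : Function.support (fun θ => p θ * L θ) = {θ | p θ ≠ 0} := by
    ext θ
    simp [(hL θ).ne']
  rw [hsupp] at hz
  have hae : (fun θ => ENNReal.ofReal (p θ)) =ᵐ[lam] 0 := by
    filter_upwards [measure_eq_zero_iff_ae_notMem.1 hz] with θ hθ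
    simp_all
  have h1 := hp.lintegral_eq_one
  rw [lintegral_congr_ae hae] at h1
  simp at h1

lemma measurable_posteriorDensity (hp : IsProbDensity lam p) (hL : Measurable L) :
    Measurable (posteriorDensity lam p L) :=
  (hp.measurable.mul hL).div_const _

lemma posteriorDensity_nonneg (hp : IsProbDensity lam p) (hL : ∀ θ, 0 < L θ) (θ : Θ) :
    0 ≤ posteriorDensity lam p L θ :=
  div_nonneg (mul_nonneg (hp.nonneg θ) (hL θ).le)
    (integral_nonneg fun θ => mul_nonneg (hp.nonneg θ) (hL θ).le)

lemma isProbabilityMeasure_posteriorMeasure (hp : IsProbDensity lam p) (hL : ∀ θ, 0 < L θ)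
    (hint : Integrable (fun θ => p θ * L θ) lam) :
    IsProbabilityMeasure (posteriorMeasure lam p L) := by
  refine ⟨?_⟩
  rw [posteriorMeasure, withDensity_apply _ .univ, Measure.restrict_univ]
  simp only [posteriorDensity]
  rw [← ofReal_integral_eq_lintegral_ofReal (hint.div_const _)
      (ae_of_all _ (posteriorDensity_nonneg hp hL)), integral_div, div_self (integral_prior_mul_pos hp hL hint).ne', ENNReal.ofReal_one]

variable {𝓨 : Type v} {N n s : ℕ} {f : (k : ℕ) → (Fin k → 𝓨) → Θ → ℝ} {Y : Fin N → 𝓨}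
  {S : (k : ℕ) → (Fin k → 𝓨) → EuclideanSpace ℝ (Fin s)}

lemma measurable_scaledLik (hf : ∀ k y, Measurable (f k y)) (U : Subsets N n) :
    Measurable (scaledLik f Y U) :=
  (hf n _).pow_const _

/-- The subsample posterior is the exact posterior reweighted by `φ_U`. -/
lemma exists_posteriorDensity_scaledLik_eq (hp : IsProbDensity lam p)
    (hf : ∀ k y, Measurable (f k y)) (hfY : ∀ θ, 0 < f N Y θ)
    (hint : Integrable (fun θ => p θ * f N Y θ) lam)
    (hfU : ∀ (θ : Θ) (U : Subsets N n), 0 < f n (subsample Y U) θ)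
    (hS : SummaryStatAssumption n f S Y) (U : Subsets N n) :
    ∃ r : ℝ, 0 < r ∧ ∀ θ, posteriorDensity lam p (scaledLik f Y U) θ =
      r * (phi f Y U θ * posteriorDensity lam p (f N Y) θ) := by
  obtain ⟨c, -, hc⟩ := exists_exp_bound_phi hfY hfU hS
  have hlik : ∀ θ, scaledLik f Y U θ = phi f Y U θ * f N Y θ := fun θ =>
    (div_mul_cancel₀ _ (hfY θ).ne').symm
  -- Without integrability the normalizing constant would have the junk value `0`.
  have hintU : Integrable (fun θ => p θ * scaledLik f Y U θ) lam := by
    refine (hint.const_mul (Real.exp c)).mono'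
      (hp.measurable.mul (measurable_scaledLik hf U)).aestronglyMeasurable
      (ae_of_all _ fun θ => ?_)
    rw [Real.norm_of_nonneg (mul_nonneg (hp.nonneg θ) (scaledLik_pos hfU U θ).le), hlik,
      mul_left_comm]
    exact mul_le_mul_of_nonneg_right (hc U θ).2 (mul_nonneg (hp.nonneg θ) (hfY θ).le)
  have hZ := integral_prior_mul_pos hp hfY hint
  have hZU := integral_prior_mul_pos hp (scaledLik_pos hfU U) hintU
  refine ⟨(∫ t, p t * f N Y t ∂lam) / ∫ t, p t * scaledLik f Y U t ∂lam, div_pos hZ hZU,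
    fun θ => ?_⟩
  rw [posteriorDensity, posteriorDensity, hlik θ]
  have := hZ.ne'
  have := hZU.ne'
  field_simp

lemma sum_ofReal_subsetWeight (hnN : n ≤ N) (S : (k : ℕ) → (Fin k → 𝓨) → EuclideanSpace ℝ (Fin s))
    (Y : Fin N → 𝓨) (ε : ℝ) :
    ∑ U : Subsets N n, ENNReal.ofReal (subsetWeight S Y ε U) = 1 := by
  obtain ⟨U, -, hU⟩ := Finset.exists_subset_card_eq (s := (Finset.univ : Finset (Fin N)))
    (n := n) (by simpa using hnN)
  have : Nonempty (Subsets N n) := ⟨⟨U, hU⟩⟩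
  rw [← ENNReal.ofReal_sum_of_nonneg fun U _ => by unfold subsetWeight; positivity]
  simp only [subsetWeight]
  rw [← Finset.sum_div, div_self (Finset.sum_pos (fun U _ => Real.exp_pos _)
    Finset.univ_nonempty).ne', ENNReal.ofReal_one]

lemma issKernel_apply [SFinite lam] (p : Θ → ℝ) (q : Θ → Θ → ℝ)
    (f : (k : ℕ) → (Fin k → 𝓨) → Θ → ℝ) (n : ℕ)
    (S : (k : ℕ) → (Fin k → 𝓨) → EuclideanSpace ℝ (Fin s)) (Y : Fin N → 𝓨) (ε : ℝ) (θ : Θ)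
    (A : Set Θ) :
    issKernel lam p q f n S Y ε θ A = ∑ U : Subsets N n,
      ENNReal.ofReal (subsetWeight S Y ε U) * subKernel lam p q f Y U θ A := by
  change (∑ U : Subsets N n,
    ENNReal.ofReal (subsetWeight S Y ε U) • subKernel lam p q f Y U θ) A = _
  simp [Measure.coe_finsetSum]

end Posterior

/-! ### The marginal ISS-MCMC chain -/

section ISSChain

variable {Θ : Type u} [MeasurableSpace Θ] {𝓨 : Type v} {lam : Measure Θ} [SFinite lam]
  {p : Θ → ℝ} {q : Θ → Θ → ℝ} {N n s : ℕ} {f : (k : ℕ) → (Fin k → 𝓨) → Θ → ℝ} {Y : Fin N → 𝓨}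
  {S : (k : ℕ) → (Fin k → 𝓨) → EuclideanSpace ℝ (Fin s)}

lemma isMarkovKernel_issKernel (hp : IsProbDensity lam p) (hq : IsTransitionDensity lam q)
    (hf : ∀ k y, Measurable (f k y)) (hnN : n ≤ N) (ε : ℝ) :
    IsMarkovKernel (issKernel lam p q f n S Y ε) := by
  refine ⟨fun θ => ⟨?_⟩⟩
  have (U : Subsets N n) : IsMarkovKernel (subKernel lam p q f Y U) :=
    isMarkovKernel_mhKernel (measurable_posteriorDensity hp (measurable_scaledLik hf U)) hq
  rw [issKernel_apply]
  simpa using sum_ofReal_subsetWeight hnN S Y ε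

lemma sum_subsetWeight_mul_const (hnN : n ≤ N) (ε : ℝ) (x : ℝ≥0∞) :
    ∑ U : Subsets N n, ENNReal.ofReal (subsetWeight S Y ε U) * x = x := by
  rw [← Finset.sum_mul, sum_ofReal_subsetWeight hnN S Y ε, one_mul]

/-- One-step comparison of the exact and the subsampled chain. -/
lemma issKernel_le_add (hp : IsProbDensity lam p) (hq : IsTransitionDensity lam q)
    (hf : ∀ k y, Measurable (f k y)) (hfY : ∀ θ, 0 < f N Y θ)
    (hint : Integrable (fun θ => p θ * f N Y θ) lam)
    (hfU : ∀ (θ : Θ) (U : Subsets N n), 0 < f n (subsample Y U) θ)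
    (hS : SummaryStatAssumption n f S Y) (hnN : n ≤ N) (ε : ℝ) (θ : Θ) (A : Set Θ)
    (hA : MeasurableSet A) :
    issKernel lam p q f n S Y ε θ A ≤ exactKernel lam p q f Y θ A +
      constA n f S Y ε * ⨆ (θ : Θ) (U : Subsets N n), constB lam p q f Y θ U := by
  set B := ⨆ (θ : Θ) (U : Subsets N n), constB lam p q f Y θ U with hB
  have hU : ∀ U : Subsets N n, subKernel lam p q f Y U θ A ≤ exactKernel lam p q f Y θ A +
      (⨆ θ : Θ, ENNReal.ofReal (f N Y θ / scaledLik f Y U θ)) * B := fun U => by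
    obtain ⟨r, hr, hrU⟩ := exists_posteriorDensity_scaledLik_eq hp hf hfY hint hfU hS U
    refine (mhKernel_reweight_le_add (measurable_posteriorDensity hp (hf N Y))
      (measurable_posteriorDensity hp (measurable_scaledLik hf U))
      (posteriorDensity_nonneg hp hfY) hq hr
      (fun θ => div_pos (scaledLik_pos hfU U θ) (hfY θ)) hrU θ A hA).trans ?_
    refine add_le_add le_rfl (mul_le_mul' ?_ (le_iSup₂ (f := fun (θ : Θ) (U : Subsets N n) =>
      constB lam p q f Y θ U) θ U))
    rw [one_div_div]
    exact le_iSup (fun θ => ENNReal.ofReal (f N Y θ / scaledLik f Y U θ)) θ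
  rw [issKernel_apply]
  calc ∑ U : Subsets N n, ENNReal.ofReal (subsetWeight S Y ε U) * subKernel lam p q f Y U θ A
      ≤ ∑ U : Subsets N n, ENNReal.ofReal (subsetWeight S Y ε U) * (exactKernel lam p q f Y θ A +
          (⨆ θ : Θ, ENNReal.ofReal (f N Y θ / scaledLik f Y U θ)) * B) :=
        Finset.sum_le_sum fun U _ => mul_le_mul' le_rfl (hU U)
    _ = _ := by
        simp only [mul_add, ← mul_assoc]
        rw [Finset.sum_add_distrib, sum_subsetWeight_mul_const hnN, ← Finset.sum_mul, constA]

lemma exists_mul_exactKernel_le_lazyKernel (hp : IsProbDensity lam p)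
    (hq : IsTransitionDensity lam q) (hf : ∀ k y, Measurable (f k y)) (hfY : ∀ θ, 0 < f N Y θ)
    (hint : Integrable (fun θ => p θ * f N Y θ) lam)
    (hfU : ∀ (θ : Θ) (U : Subsets N n), 0 < f n (subsample Y U) θ)
    (hS : SummaryStatAssumption n f S Y) (hnN : n ≤ N) (ε : ℝ) :
    ∃ c : ℝ≥0∞, c ≠ 0 ∧ ∀ θ A, MeasurableSet A →
      c * exactKernel lam p q f Y θ A ≤ lazyKernel (issKernel lam p q f n S Y ε) θ A := by
  obtain ⟨c, hc0, hc⟩ := exists_exp_bound_phi hfY hfU hS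
  refine ⟨2⁻¹ * ENNReal.ofReal (Real.exp (-c - c)),
    mul_ne_zero (by simp) (by simpa using Real.exp_pos _), fun θ A hA => ?_⟩
  have hU : ∀ U : Subsets N n, ENNReal.ofReal (Real.exp (-c - c)) * exactKernel lam p q f Y θ A ≤
      Measure.dirac θ A + subKernel lam p q f Y U θ A := fun U => by
    obtain ⟨r, hr, hrU⟩ := exists_posteriorDensity_scaledLik_eq hp hf hfY hint hfU hS U
    have hφ : ∀ θ, 0 < phi f Y U θ := fun θ => (Real.exp_pos _).trans_le (hc U θ).1
    refine mul_mhKernel_le_lazy (measurable_posteriorDensity hp (hf N Y))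
      (measurable_posteriorDensity hp (measurable_scaledLik hf U))
      (posteriorDensity_nonneg hp hfY) hq hr hφ hrU (Real.exp_pos _).le
      (Real.exp_le_one_iff.2 (by linarith)) (fun θ θ' => ?_) θ A
    rw [Real.exp_sub]
    exact div_le_div₀ (hφ θ').le (hc U θ').1 (hφ θ) (hc U θ).2
  rw [lazyKernel_apply, issKernel_apply, ← mul_add, mul_assoc]
  gcongr
  rw [← sum_subsetWeight_mul_const (S := S) (Y := Y) hnN ε (Measure.dirac θ A),
    ← sum_subsetWeight_mul_const (S := S) (Y := Y) hnN ε
      (ENNReal.ofReal (Real.exp (-c - c)) * exactKernel lam p q f Y θ A),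
    ← Finset.sum_add_distrib]
  refine Finset.sum_le_sum fun U _ => ?_
  rw [← mul_add]
  exact mul_le_mul' le_rfl (hU U)

end ISSChain

/-! ### Constants from uniform ergodicity -/

/-- Uniform ergodicity makes the oscillation of `θ ↦ K^i(θ, A)` decay geometrically. -/
lemma UniformlyErgodic.osc_le {Θ : Type u} [MeasurableSpace Θ] {K : Kernel Θ Θ}
    [IsMarkovKernel K] {π : Measure Θ} [IsProbabilityMeasure π] {C ϱ : ℝ}
    (hK : UniformlyErgodic K π C ϱ) (i : ℕ) (A : Set Θ) (hA : MeasurableSet A) (x y : Θ) :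
    (K ^ i) x A ≤ (K ^ i) y A + 2 * ENNReal.ofReal (C * ϱ ^ i) := by
  have h : ∀ z, tvDist π ((K ^ i) z) ≤ ENNReal.ofReal (C * ϱ ^ i) := fun z =>
    (le_iSup (fun θ => tvDist π ((K ^ i) θ)) z).trans (hK i)
  calc (K ^ i) x A ≤ π A + tvDist π ((K ^ i) x) := by
        rw [tvDist_comm]; exact measure_le_add_tvDist _ _ hA
    _ ≤ (K ^ i) y A + tvDist π ((K ^ i) y) + tvDist π ((K ^ i) x) := by
        gcongr; exact measure_le_add_tvDist _ _ hA
    _ ≤ (K ^ i) y A + ENNReal.ofReal (C * ϱ ^ i) + ENNReal.ofReal (C * ϱ ^ i) := by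
        gcongr <;> exact h _
    _ = _ := by ring

/-- The total oscillation over all numbers of steps, which is the constant `κ` of the perturbation
bound. The absolute value is there because `C` is not assumed to be nonnegative. -/
lemma sum_two_mul_ofReal_geometric_le (C : ℝ) {ϱ : ℝ} (hϱ0 : 0 < ϱ) (hϱ1 : ϱ < 1) (i : ℕ) :
    ∑ j ∈ Finset.range i, 2 * ENNReal.ofReal (C * ϱ ^ j) ≤
      (Real.toNNReal (2 * |C| / (1 - ϱ)) : ℝ≥0) := by
  have hj : ∀ j, 2 * ENNReal.ofReal (C * ϱ ^ j) ≤ ENNReal.ofReal (2 * |C| * ϱ ^ j) := fun j => by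
    rw [mul_assoc, ENNReal.ofReal_mul zero_le_two, ENNReal.ofReal_ofNat]
    gcongr
    exact le_abs_self C
  refine (Finset.sum_le_sum fun j _ => hj j).trans ?_
  rw [← ENNReal.ofReal_sum_of_nonneg fun j _ => by positivity, ← Finset.mul_sum, div_eq_mul_inv,
    ← tsum_geometric_of_lt_one hϱ0.le hϱ1]
  refine ENNReal.ofReal_le_ofReal (mul_le_mul_of_nonneg_left ?_ (by positivity))
  exact (summable_geometric_of_lt_one hϱ0.le hϱ1).sum_le_tsum _ fun j _ => by positivity

end ISSMCMC

theorem mainTheorem1 (C ϱ : ℝ) (hϱ0 : 0 < ϱ) (hϱ1 : ϱ < 1) :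
    ∃ κ : ℝ≥0,
      ∀ (Θ : Type u) [MeasurableSpace Θ] (𝓨 : Type v)
        (lam : Measure Θ) [SigmaFinite lam]
        (p : Θ → ℝ) (_hp : ISSMCMC.IsProbDensity lam p)
        (q : Θ → Θ → ℝ) (_hq : ISSMCMC.IsTransitionDensity lam q)
        (N : ℕ) (Y : Fin N → 𝓨) (f : (k : ℕ) → (Fin k → 𝓨) → Θ → ℝ)
        (_hf : ∀ k y, Measurable (f k y))
        (_hfY : ∀ θ, 0 < f N Y θ)
        (_hint : Integrable (fun θ => p θ * f N Y θ) lam)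
        (_hK : ISSMCMC.UniformlyErgodic (ISSMCMC.exactKernel lam p q f Y)
          (ISSMCMC.posteriorMeasure lam p (f N Y)) C ϱ)
        (n : ℕ) (_hn1 : 1 ≤ n) (_hnN : n ≤ N)
        (s : ℕ) (S : (k : ℕ) → (Fin k → 𝓨) → EuclideanSpace ℝ (Fin s))
        (ε : ℝ) (_hε : 0 ≤ ε)
        (_hfU : ∀ (θ : Θ) (U : ISSMCMC.Subsets N n), 0 < f n (ISSMCMC.subsample Y U) θ)
        (_hS : ISSMCMC.SummaryStatAssumption n f S Y),
        (∀ (i : ℕ) (θ₀ : Θ),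
          ISSMCMC.tvDist ((ISSMCMC.exactKernel lam p q f Y ^ i) θ₀)
              ((ISSMCMC.issKernel lam p q f n S Y ε ^ i) θ₀) ≤
            κ * ISSMCMC.constA n f S Y ε *
              ⨆ (θ : Θ) (U : ISSMCMC.Subsets N n), ISSMCMC.constB lam p q f Y θ U) ∧
        (∃ l : ℝ≥0∞,
          Tendsto (fun i : ℕ => ⨆ θ : Θ, ISSMCMC.tvDist (ISSMCMC.posteriorMeasure lam p (f N Y))
              ((ISSMCMC.issKernel lam p q f n S Y ε ^ i) θ)) atTop (𝓝 l) ∧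
          l ≤ κ * ISSMCMC.constA n f S Y ε *
            ⨆ (θ : Θ) (U : ISSMCMC.Subsets N n), ISSMCMC.constB lam p q f Y θ U) ∧
        (∃ π' : Measure Θ, IsProbabilityMeasure π' ∧
          Kernel.Invariant (ISSMCMC.issKernel lam p q f n S Y ε) π' ∧
          ISSMCMC.tvDist (ISSMCMC.posteriorMeasure lam p (f N Y)) π' ≤
            κ * ISSMCMC.constA n f S Y ε *
              ⨆ (θ : Θ) (U : ISSMCMC.Subsets N n), ISSMCMC.constB lam p q f Y θ U) := by
  refine ⟨Real.toNNReal (2 * |C| / (1 - ϱ)), ?_⟩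
  intro Θ _ 𝓨 lam _ p hp q hq N Y f hf hfY hint hK n _ hnN s S ε _ hfU hS
  open ISSMCMC in
  have hπ := isProbabilityMeasure_posteriorMeasure hp hfY hint
  have hΘ : Nonempty Θ := nonempty_of_isProbabilityMeasure (posteriorMeasure lam p (f N Y))
  have hK1 : IsMarkovKernel (exactKernel lam p q f Y) :=
    isMarkovKernel_mhKernel (measurable_posteriorDensity hp (hf N Y)) hq
  have hK2 : IsMarkovKernel (issKernel lam p q f n S Y ε) :=
    isMarkovKernel_issKernel hp hq hf hnN ε
  have hstep := issKernel_le_add hp hq hf hfY hint hfU hS hnN ε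
  obtain ⟨c, hc0, hc⟩ := exists_mul_exactKernel_le_lazyKernel hp hq hf hfY hint hfU hS hnN ε
  obtain ⟨π', hπ', hinv⟩ := exists_invariant_of_dominates _ _ hϱ0 hϱ1 hK hc0 hc
  replace hinv := Invariant.of_lazyKernel hinv
  set K := exactKernel lam p q f Y
  set K' := issKernel lam p q f n S Y ε
  set π := posteriorMeasure lam p (f N Y)
  simp only [mul_assoc]
  set δ := constA n f S Y ε * ⨆ (θ : Θ) (U : Subsets N n), constB lam p q f Y θ U
  set D : ℝ≥0∞ := (Real.toNNReal (2 * |C| / (1 - ϱ)) : ℝ≥0) * δ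
  have hpow : ∀ i θ A, MeasurableSet A → (K' ^ i) θ A ≤ (K ^ i) θ A + D := fun i θ A hA => by
    refine (pow_le_pow_add_sum K K' hstep (fun j => by finiteness) hK.osc_le i θ A hA).trans ?_
    exact add_le_add le_rfl (mul_le_mul' (sum_two_mul_ofReal_geometric_le C hϱ0 hϱ1 i) le_rfl)
  have herg : ∀ i θ A, MeasurableSet A → (K' ^ i) θ A ≤ π A + (ENNReal.ofReal (C * ϱ ^ i) + D) :=
    fun i θ A hA => by
    refine (hpow i θ A hA).trans ?_
    rw [← add_assoc]
    gcongr
    refine (measure_le_add_tvDist ((K ^ i) θ) π hA).trans ?_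
    rw [tvDist_comm]
    gcongr
    exact (le_iSup (fun θ => tvDist π ((K ^ i) θ)) θ).trans (hK i)
  have hlim : Tendsto (fun i : ℕ => ENNReal.ofReal (C * ϱ ^ i) + D) atTop (𝓝 D) := by
    have : Tendsto (fun m : ℕ => C * ϱ ^ m) atTop (𝓝 (C * 0)) :=
      (tendsto_pow_atTop_nhds_zero_of_lt_one hϱ0.le hϱ1).const_mul C
    simpa using (ENNReal.tendsto_ofReal this).add_const D
  refine ⟨fun i θ => ?_, ?_, π', hπ', hinv, ?_⟩
  · rw [tvDist_comm]
    exact tvDist_le (hpow i θ)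
  · -- The worst-case distance to `π` is antitone, so it converges even if the chain is periodic.
    have hconv := tendsto_atTop_iInf (antitone_iSup_tvDist_pow K' π)
    refine ⟨_, hconv, le_of_tendsto_of_tendsto' hconv hlim fun i => iSup_le fun θ => ?_⟩
    rw [tvDist_comm]
    exact tvDist_le (herg i θ)
  · refine ge_of_tendsto' hlim fun i => ?_
    rw [tvDist_comm]
    refine tvDist_le fun A hA => ?_
    rw [← (Invariant.pow hinv i).def, Measure.bind_apply hA (Kernel.aemeasurable _)]
    exact lintegral_le_of_forall_le fun θ => herg i θ A hA
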